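/- For a nonempty set $\mathsf A$ of real $d\times d$ matrices let $$\check\varrho(\mathsf A)=\lim_{n\to\infty}\inf\{\|A_n\cdots A_1\|^{1/n}: A_1,\dots,A_n\in\mathsf A\}=\inf_{n\ge 1}\inf\{\|A_n\cdots A_1\|^{1/n}: A_1,\dots,A_n\in\mathsf A\}$$ denote its lower spectral radius, where $\|\cdot\|$ is the Euclidean operator norm. Let $\mathcal K(GL_2(\mathbb R))$ and $\mathcal K(SL_2(\mathbb R))$ denote the sets of all nonempty compact subsets of $GL_2(\mathbb R)$ and of $SL_2(\mathbb R)$, respectively, each equipped with the Hausdorff metric $$d_H(\mathsf A,\mathsf B)=\max\Big\{\sup_{A\in\mathsf A}\inf_{B\in\mathsf B}\|A-B\|,\ \sup_{B\in\mathsf B}\inf_{A\in\mathsf A}\|A-B\|\Big\}.$$ Then the function $\check\varrho\colon\mathcal K(GL_2(\mathbb R))\to[0,\infty)$ is continuous at every $\mathsf A\in\mathcal K(SL_2(\mathbb R))$. In particular, the restriction $\check\varrho\colon\mathcal K(SL_2(\mathbb R))\to[0,\infty)$ is continuous. -/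

import Mathlib

open Filter Topology TopologicalSpace
/- Matrices carry the operator norm induced by the Euclidean norm, and its metric. -/
open scoped Matrix.Norms.L2Operator

/-- The set of all products `Aₙ ⋯ A₁` of `n` elements of `S`. -/
def matrixProducts {d : ℕ} (S : Set (Matrix (Fin d) (Fin d) ℝ)) (n : ℕ) :
    Set (Matrix (Fin d) (Fin d) ℝ) :=
  {P | ∃ l : List (Matrix (Fin d) (Fin d) ℝ), l.length = n ∧ (∀ X ∈ l, X ∈ S) ∧ l.prod = P}

/-- The lower spectral radius: the infimum of `‖Aₙ ⋯ A₁‖ ^ (1 / n)` over all `n ≥ 1` and all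
`A₁, …, Aₙ ∈ S`. For nonempty `S` it is the limit as `n → ∞` of the infimum over products of
length `n`, see `tendsto_lowerSpectralRadius`. -/
noncomputable def lowerSpectralRadius {d : ℕ} (S : Set (Matrix (Fin d) (Fin d) ℝ)) : ℝ :=
  sInf {r : ℝ | ∃ n : ℕ, 1 ≤ n ∧ ∃ P ∈ matrixProducts S n, r = ‖P‖ ^ (1 / (n : ℝ))}

/-- The nonempty compact sets of invertible `d × d` matrices, with the Hausdorff metric, whose
topology is definitionally the one that Mathlib puts on `NonemptyCompacts`. -/
abbrev KGL (d : ℕ) : Type :=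
  {K : NonemptyCompacts (Matrix (Fin d) (Fin d) ℝ) // ∀ A ∈ K, A.det ≠ 0}

/-- The nonempty compact sets of `d × d` matrices of determinant one, with the Hausdorff metric. -/
abbrev KSL (d : ℕ) : Type :=
  {K : NonemptyCompacts (Matrix (Fin d) (Fin d) ℝ) // ∀ A ∈ K, A.det = 1}

/-- `KSL d` as a part of `KGL d`. -/
def KSL.toKGL {d : ℕ} (K : KSL d) : KGL d :=
  ⟨K.1, fun A hA => by rw [K.2 A hA]; exact one_ne_zero⟩

/-- The lower spectral radius as a function on `KGL d`. -/
noncomputable def KGL.lsr {d : ℕ} (K : KGL d) : ℝ :=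
  lowerSpectralRadius (K.1 : Set (Matrix (Fin d) (Fin d) ℝ))

/-- The lower spectral radius is the limit of the infima over products of length `n`. -/
theorem tendsto_lowerSpectralRadius {d : ℕ} {S : Set (Matrix (Fin d) (Fin d) ℝ)}
    (hS : S.Nonempty) :
    Tendsto (fun n : ℕ => sInf {r : ℝ | ∃ P ∈ matrixProducts S n, r = ‖P‖ ^ (1 / (n : ℝ))})
      atTop (𝓝 (lowerSpectralRadius S)) := by
  obtain ⟨R, hR⟩ := hS
  have hpow : ∀ n, R ^ n ∈ matrixProducts S n := fun n =>
    ⟨List.replicate n R, by simp, fun X hX => by rw [List.eq_of_mem_replicate hX]; exact hR,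
      by simp⟩
  have hmul : ∀ m n P Q, P ∈ matrixProducts S m → Q ∈ matrixProducts S n →
      P * Q ∈ matrixProducts S (m + n) := by
    rintro m n P Q ⟨l, hl, hl', rfl⟩ ⟨k, hk, hk', rfl⟩
    refine ⟨l ++ k, by simp [hl, hk], fun X hX => ?_, by simp⟩
    rcases List.mem_append.1 hX with h | h
    exacts [hl' X h, hk' X h]
  have hbdd : ∀ n : ℕ, BddBelow {r : ℝ | ∃ P ∈ matrixProducts S n, r = ‖P‖ ^ (1 / (n : ℝ))} :=
    fun n => ⟨0, by rintro _ ⟨P, -, rfl⟩; positivity⟩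
  have hbdd' : BddBelow {r : ℝ | ∃ n : ℕ, 1 ≤ n ∧ ∃ P ∈ matrixProducts S n,
      r = ‖P‖ ^ (1 / (n : ℝ))} := ⟨0, by rintro _ ⟨n, -, P, -, rfl⟩; positivity⟩
  have hne : {r : ℝ | ∃ n : ℕ, 1 ≤ n ∧ ∃ P ∈ matrixProducts S n,
      r = ‖P‖ ^ (1 / (n : ℝ))}.Nonempty := ⟨_, 1, le_rfl, R ^ 1, hpow 1, rfl⟩
  have hnonneg : 0 ≤ lowerSpectralRadius S := by
    refine le_csInf hne ?_
    rintro _ ⟨n, -, P, -, rfl⟩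
    positivity
  refine tendsto_order.2 ⟨fun a ha => ?_, fun b hb => ?_⟩
  · filter_upwards [eventually_ge_atTop 1] with n hn
    refine ha.trans_le (le_csInf ⟨_, R ^ n, hpow n, rfl⟩ ?_)
    rintro _ ⟨P, hP, rfl⟩
    exact csInf_le hbdd' ⟨n, hn, P, hP, rfl⟩
  · obtain ⟨_, ⟨m, hm, P, hP, rfl⟩, hlt⟩ := exists_lt_of_csInf_lt hne hb
    obtain ⟨c, hc, hcb⟩ := exists_between hlt
    have hc0 : 0 < c := lt_of_le_of_lt (by positivity) hc
    have hm0 : (m : ℝ) ≠ 0 := by positivity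
    have hPc : ‖P‖ ≤ c ^ m := by
      have h := Real.rpow_le_rpow (by positivity) hc.le (Nat.cast_nonneg (α := ℝ) m)
      rwa [← Real.rpow_mul (norm_nonneg _), one_div_mul_cancel hm0, Real.rpow_one,
        Real.rpow_natCast] at h
    have hq : ∀ q r, P ^ q * R ^ r ∈ matrixProducts S (m * q + r) ∧
        ‖P ^ q * R ^ r‖ ≤ c ^ (m * q) * ‖R ^ r‖ := by
      intro q r
      induction q with
      | zero => simpa using hpow r
      | succ q ih =>
        rw [pow_succ', mul_assoc]
        constructor
        · have := hmul _ _ _ _ hP ih.1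
          rwa [show m * (q + 1) + r = m + (m * q + r) by ring]
        · calc ‖P * (P ^ q * R ^ r)‖ ≤ ‖P‖ * ‖P ^ q * R ^ r‖ := norm_mul_le _ _
            _ ≤ c ^ m * (c ^ (m * q) * ‖R ^ r‖) := by
              gcongr
              exact ih.2
            _ = c ^ (m * (q + 1)) * ‖R ^ r‖ := by ring
    set C : ℝ := 1 + ∑ i ∈ Finset.range m, ‖R ^ i‖ / c ^ i with hC
    have hC0 : 0 < C := by positivity
    have hlim : Tendsto (fun n : ℕ => C ^ (1 / (n : ℝ)) * c) atTop (𝓝 c) := by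
      have h := (Real.continuousAt_const_rpow (a := C) (b := 0) hC0.ne').tendsto.comp
        tendsto_one_div_atTop_nhds_zero_nat
      simpa using h.mul_const c
    filter_upwards [eventually_ge_atTop 1, hlim.eventually_lt_const hcb] with n hn hlt'
    have hn0 : (n : ℝ) ≠ 0 := by positivity
    obtain ⟨hmem, hnorm⟩ := hq (n / m) (n % m)
    rw [Nat.div_add_mod] at hmem
    refine lt_of_le_of_lt (csInf_le (hbdd n) ⟨_, hmem, rfl⟩) (lt_of_le_of_lt ?_ hlt')
    have hr : ‖R ^ (n % m)‖ ≤ C * c ^ (n % m) := by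
      rw [← div_le_iff₀ (by positivity)]
      have h := Finset.single_le_sum (f := fun i => ‖R ^ i‖ / c ^ i)
        (fun i _ => by positivity) (Finset.mem_range.2 (Nat.mod_lt n hm))
      linarith
    have hle : ‖P ^ (n / m) * R ^ (n % m)‖ ≤ C * c ^ n := by
      calc _ ≤ c ^ (m * (n / m)) * ‖R ^ (n % m)‖ := hnorm
        _ ≤ c ^ (m * (n / m)) * (C * c ^ (n % m)) := by gcongr
        _ = C * c ^ (m * (n / m) + n % m) := by ring
        _ = C * c ^ n := by rw [Nat.div_add_mod]
    calc _ ≤ (C * c ^ n) ^ (1 / (n : ℝ)) := Real.rpow_le_rpow (norm_nonneg _) hle (by positivity)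
      _ = C ^ (1 / (n : ℝ)) * c := by
        rw [Real.mul_rpow hC0.le (by positivity), ← Real.rpow_natCast, ← Real.rpow_mul hc0.le,
          mul_one_div_cancel hn0, Real.rpow_one]

-- Upper semicontinuity is general: the radius is an infimum of expressions continuous in finitely
-- many factors. For lower semicontinuity at a set in SL₂, where the radius is at least 1, there are
-- two cases. If it equals 1, then `|det P| ≤ ‖P‖ ^ 2` and continuity of the determinant suffice. If
-- it is `lam > 1`, all products of length `n` have norm at least `lam ^ n`. The key claim
-- (`exists_mul_norm_mul_norm_le_norm_mul`) is that then `c ‖A‖ ‖B‖ ≤ ‖A B‖ ` for all products `A`,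
-- `B`. Its engine is the Plücker-type inequality `norm_mul_mul_norm_mul_le` and its companion
-- `abs_det_mul_norm_mul_norm_le`. They show that strong cancellation in `A B C` forces `B` to be
-- large, and a growth rate `μ` for such `B` improves to `μ ^ 2` (`CancellationGrowth.sq`).
-- Iterating, the rate would exceed the bound `M` on the factors, so strong cancellation is
-- impossible around long `B`. For blocks of a large fixed length `N`, near-multiplicativity, large
-- norm and relatively small determinant are open conditions. They survive perturbation, even off
-- SL₂, and `pow_length_le_norm_list_prod` turns these local conditions into growth of all products
-- of blocks.

local notation "M₂" => Matrix (Fin 2) (Fin 2) ℝ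

/-! ### Norm inequalities for products of `2 × 2` matrices. -/

/-- In dimension two the adjugate is the transpose conjugated by a quarter turn. -/
theorem norm_adjugate_le (B : M₂) : ‖B.adjugate‖ ≤ ‖B‖ := by
  set J : M₂ := !![0, 1; -1, 0] with hJ
  have hJn : ‖J‖ = 1 := by
    have h := CStarRing.norm_star_mul_self (x := J)
    have h1 : star J * J = 1 := by
      rw [Matrix.star_eq_conjTranspose]
      ext i j
      fin_cases i <;> fin_cases j <;> simp [hJ, Matrix.mul_apply]
    rw [h1, norm_one] at h
    nlinarith [norm_nonneg J]
  have hB : B.adjugate = J * star B * star J := by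
    rw [Matrix.star_eq_conjTranspose, Matrix.star_eq_conjTranspose, Matrix.adjugate_fin_two]
    ext i j
    fin_cases i <;> fin_cases j <;>
      simp [hJ, Matrix.mul_apply, Fin.sum_univ_two, Matrix.vecMul, dotProduct]
  calc ‖B.adjugate‖ = ‖J * star B * star J‖ := by rw [hB]
    _ ≤ ‖J‖ * ‖star B‖ * ‖star J‖ :=
      (norm_mul_le _ _).trans (mul_le_mul_of_nonneg_right (norm_mul_le _ _) (norm_nonneg _))
    _ = ‖B‖ := by rw [norm_star, norm_star, hJn]; ring

theorem abs_det_mul_norm_le_left (A B : M₂) : |B.det| * ‖A‖ ≤ ‖A * B‖ * ‖B‖ := by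
  calc |B.det| * ‖A‖ = ‖A * B * B.adjugate‖ := by
        rw [mul_assoc, Matrix.mul_adjugate, Matrix.mul_smul, mul_one, norm_smul, Real.norm_eq_abs]
    _ ≤ ‖A * B‖ * ‖B.adjugate‖ := norm_mul_le _ _
    _ ≤ ‖A * B‖ * ‖B‖ := by gcongr; exact norm_adjugate_le B

theorem abs_det_mul_norm_le_right (B C : M₂) : |B.det| * ‖C‖ ≤ ‖B‖ * ‖B * C‖ := by
  calc |B.det| * ‖C‖ = ‖B.adjugate * (B * C)‖ := by
        rw [← mul_assoc, Matrix.adjugate_mul, Matrix.smul_mul, one_mul, norm_smul,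
          Real.norm_eq_abs]
    _ ≤ ‖B.adjugate‖ * ‖B * C‖ := norm_mul_le _ _
    _ ≤ ‖B‖ * ‖B * C‖ := by gcongr; exact norm_adjugate_le B

theorem abs_det_le_sq_norm (B : M₂) : |B.det| ≤ ‖B‖ ^ 2 := by
  have h := abs_det_mul_norm_le_left 1 B
  rw [norm_one, one_mul, mul_one] at h
  nlinarith

theorem norm_sq_euclidean_two (x : EuclideanSpace ℝ (Fin 2)) : ‖x‖ ^ 2 = x 0 ^ 2 + x 1 ^ 2 := by
  simp [EuclideanSpace.norm_sq_eq, Fin.sum_univ_two]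

theorem abs_wedge_le (x y : EuclideanSpace ℝ (Fin 2)) :
    |x 0 * y 1 - x 1 * y 0| ≤ ‖x‖ * ‖y‖ := by
  apply abs_le_of_sq_le_sq _ (by positivity)
  rw [mul_pow, norm_sq_euclidean_two, norm_sq_euclidean_two]
  nlinarith [sq_nonneg (x 0 * y 0 + x 1 * y 1)]

/-- The action of `B` on bivectors of the plane is multiplication by `B.det`. -/
theorem inner_mul_inner_eq_add_det_mul (B : M₂) (p v y z : EuclideanSpace ℝ (Fin 2)) :
    inner ℝ p (Matrix.toEuclideanCLM (𝕜 := ℝ) B y) * inner ℝ v (Matrix.toEuclideanCLM (𝕜 := ℝ) B z)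
      = inner ℝ p (Matrix.toEuclideanCLM (𝕜 := ℝ) B z) *
          inner ℝ v (Matrix.toEuclideanCLM (𝕜 := ℝ) B y)
        + B.det * ((p 0 * v 1 - p 1 * v 0) * (y 0 * z 1 - y 1 * z 0)) := by
  simp only [PiLp.inner_apply, Matrix.ofLp_toEuclideanCLM, Matrix.mulVec, dotProduct,
    Fin.sum_univ_two, Matrix.det_fin_two, RCLike.inner_apply, conj_trivial]
  ring

/-- Three-term Plücker relation for a `2 × 2` matrix, in bilinear form. -/
theorem norm_mul_apply_mul_norm_mul_apply_le (A B C : M₂) (x y : EuclideanSpace ℝ (Fin 2)) :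
    ‖Matrix.toEuclideanCLM (𝕜 := ℝ) (A * B) y‖ * ‖Matrix.toEuclideanCLM (𝕜 := ℝ) (B * C) x‖ ≤
      (‖A * B * C‖ * ‖B‖ + |B.det| * (‖A‖ * ‖C‖)) * (‖x‖ * ‖y‖) := by
  set φ := Matrix.toEuclideanCLM (n := Fin 2) (𝕜 := ℝ)
  have hn : ∀ (D : M₂) z, ‖φ D z‖ ≤ ‖D‖ * ‖z‖ := fun D z => (φ D).le_opNorm z
  set u := φ (A * B) y
  set v := φ (B * C) x
  set p := φ (star A) u
  set z := φ C x
  -- With `p = Aᵀ u` and `z = C x`, both squared norms are values of the bilinear form of `B`;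
  -- exchanging `y` and `z` produces `A * B * C` and a wedge term.
  have key : ‖u‖ ^ 2 * ‖v‖ ^ 2 = inner ℝ u (φ (A * B * C) x) * inner ℝ v (φ B y)
      + B.det * ((p 0 * v 1 - p 1 * v 0) * (y 0 * z 1 - y 1 * z 0)) := by
    have hadj : ∀ w, inner ℝ p w = inner ℝ u (φ A w) := fun w => by
      simp only [p, map_star, ContinuousLinearMap.star_eq_adjoint,
        ContinuousLinearMap.adjoint_inner_left]
    have hmul : ∀ (D E : M₂) w, φ (D * E) w = φ D (φ E w) := fun D E w => by
      rw [map_mul]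
      rfl
    have hu : ‖u‖ ^ 2 = inner ℝ p (φ B y) := by
      rw [hadj, ← hmul, real_inner_self_eq_norm_sq]
    have hv : ‖v‖ ^ 2 = inner ℝ v (φ B z) := by
      rw [← hmul, real_inner_self_eq_norm_sq]
    have hw : inner ℝ u (φ (A * B * C) x) = inner ℝ p (φ B z) := by
      rw [hadj, ← hmul, ← hmul]
    rw [hu, hv, hw]
    exact inner_mul_inner_eq_add_det_mul B p v y z
  have h1 := abs_real_inner_le_norm u (φ (A * B * C) x)
  have h2 := abs_real_inner_le_norm v (φ B y)
  have h3 := abs_wedge_le p v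
  have h4 := abs_wedge_le y z
  have hp : ‖p‖ ≤ ‖A‖ * ‖u‖ := by simpa [norm_star] using hn (star A) u
  have hz : ‖z‖ ≤ ‖C‖ * ‖x‖ := hn C x
  have h5 : ‖u‖ ^ 2 * ‖v‖ ^ 2 ≤ (‖A * B * C‖ * ‖B‖ + |B.det| * (‖A‖ * ‖C‖)) * (‖x‖ * ‖y‖)
      * (‖u‖ * ‖v‖) := by
    rw [key]
    refine (le_abs_self _).trans ((abs_add_le _ _).trans ?_)
    rw [abs_mul, abs_mul, abs_mul (p 0 * v 1 - p 1 * v 0)]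
    calc _ ≤ (‖u‖ * (‖A * B * C‖ * ‖x‖)) * (‖v‖ * (‖B‖ * ‖y‖)) + |B.det| *
          (((‖A‖ * ‖u‖) * ‖v‖) * (‖y‖ * (‖C‖ * ‖x‖))) := by
          gcongr
          · exact h1.trans (by gcongr; exact hn _ _)
          · exact h2.trans (by gcongr; exact hn _ _)
          · exact h3.trans (by gcongr)
          · exact h4.trans (by gcongr)
      _ = _ := by ring
  rcases (by positivity : 0 ≤ ‖u‖ * ‖v‖).eq_or_lt with h0 | h0
  · rw [← h0]; positivity
  · nlinarith

theorem norm_mul_mul_norm_mul_le (A B C : M₂) :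
    ‖A * B‖ * ‖B * C‖ ≤ ‖A * B * C‖ * ‖B‖ + |B.det| * (‖A‖ * ‖C‖) := by
  set φ := Matrix.toEuclideanCLM (n := Fin 2) (𝕜 := ℝ)
  set R := ‖A * B * C‖ * ‖B‖ + |B.det| * (‖A‖ * ‖C‖)
  have hR : 0 ≤ R := by positivity
  have h1 : ∀ y, ‖φ (A * B) y‖ * ‖B * C‖ ≤ R * ‖y‖ := by
    intro y
    have h := ContinuousLinearMap.opNorm_le_bound (‖φ (A * B) y‖ • φ (B * C)) (M := R * ‖y‖)
      (by positivity) (fun x => by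
        rw [smul_apply, norm_smul, norm_norm]
        linarith [norm_mul_apply_mul_norm_mul_apply_le A B C x y])
    rwa [norm_smul, norm_norm] at h
  have h := ContinuousLinearMap.opNorm_le_bound (‖B * C‖ • φ (A * B)) (M := R) hR (fun x => by
        rw [smul_apply, norm_smul, norm_norm]
        linarith [h1 x])
  rw [norm_smul, norm_norm] at h
  rw [mul_comm]
  exact h

/-- This is the previous inequality for `A * B`, `B.adjugate`, `B * C`, whose products collapse to
multiples of `A`, `C` and `A * B * C` by `B.det`. -/
theorem abs_det_mul_norm_mul_norm_le (A B C : M₂) :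
    |B.det| * (‖A‖ * ‖C‖) ≤ ‖A * B‖ * ‖B * C‖ + ‖A * B * C‖ * ‖B‖ := by
  rcases eq_or_ne B.det 0 with h0 | h0
  · rw [h0, abs_zero, zero_mul]; positivity
  have h := norm_mul_mul_norm_mul_le (A * B) B.adjugate (B * C)
  have e1 : A * B * B.adjugate = B.det • A := by
    rw [mul_assoc, Matrix.mul_adjugate, Matrix.mul_smul, mul_one]
  have e2 : B.adjugate * (B * C) = B.det • C := by
    rw [← mul_assoc, Matrix.adjugate_mul, Matrix.smul_mul, one_mul]
  have e3 : A * B * B.adjugate * (B * C) = B.det • (A * B * C) := by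
    rw [e1, Matrix.smul_mul, mul_assoc]
  have e4 : |B.adjugate.det| = |B.det| := by
    rw [Matrix.det_adjugate]; simp
  rw [e3, e1, e2, e4, norm_smul, norm_smul, norm_smul, Real.norm_eq_abs] at h
  have hd : 0 < |B.det| := abs_pos.2 h0
  have h2 : |B.det| * ‖A * B * C‖ * ‖B.adjugate‖ ≤ |B.det| * ‖A * B * C‖ * ‖B‖ := by
    gcongr; exact norm_adjugate_le B
  refine le_of_mul_le_mul_left ?_ hd
  linarith

/-! ### Growth and cancellation in products of determinant one. -/

theorem norm_list_prod_le_pow {M : ℝ} (hM : 1 ≤ M) {l : List M₂} (hl : ∀ X ∈ l, ‖X‖ ≤ M) :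
    ‖l.prod‖ ≤ M ^ l.length := by
  induction l with
  | nil => simp
  | cons D l ih =>
    rw [List.prod_cons, List.length_cons, pow_succ']
    refine (norm_mul_le _ _).trans (mul_le_mul (hl D (by simp)) ?_ (norm_nonneg _) (by linarith))
    exact ih fun X hX => hl X (by simp [hX])

theorem det_list_prod_eq_one {l : List M₂} (hl : ∀ X ∈ l, X.det = 1) : l.prod.det = 1 := by
  induction l with
  | nil => simp
  | cons D l ih =>
    rw [List.prod_cons, Matrix.det_mul, hl D (by simp), ih fun X hX => hl X (by simp [hX]),
      one_mul]

theorem norm_pos_of_det_eq_one {X : M₂} (hX : X.det = 1) : 0 < ‖X‖ := by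
  have := abs_det_le_sq_norm X
  rw [hX, abs_one] at this
  by_contra h
  have h0 : ‖X‖ = 0 := le_antisymm (not_lt.1 h) (norm_nonneg _)
  norm_num [h0] at this

/-- If all prefixes `X C₁ ⋯ Cₖ` grow exponentially in `k`, then the relative size of `A X` is
almost bounded by that of `A X C`. -/
theorem norm_mul_div_norm_le {M lam : ℝ} (hlam : 1 < lam) (A : M₂) (l : List M₂)
    (hdet : ∀ D ∈ l, D.det = 1) (hM : ∀ D ∈ l, ‖D‖ ≤ M) :
    ∀ (X : M₂) (T : ℝ), 0 < T → X.det = 1 →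
      (∀ l₁ l₂, l = l₁ ++ l₂ → T * lam ^ l₁.length ≤ ‖X * l₁.prod‖ ^ 2) →
      ‖A * X‖ / ‖X‖ ≤ ‖A * X * l.prod‖ / ‖X * l.prod‖ +
        ‖A‖ * (M ^ 2 * (lam / (lam - 1)) / T) := by
  have hl1 : 0 < lam - 1 := by linarith
  have hl0 : 0 < lam := by linarith
  induction l with
  | nil =>
    intro X T hT _ _
    rw [List.prod_nil, mul_one, mul_one]
    have : 0 ≤ ‖A‖ * (M ^ 2 * (lam / (lam - 1)) / T) := by positivity
    linarith
  | cons D l ih =>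
    intro X T hT hX h
    have hD : D.det = 1 := hdet D (by simp)
    have hXD : (X * D).det = 1 := by rw [Matrix.det_mul, hX, hD, one_mul]
    -- Absorbing `D` into `X` shortens every prefix by one, so `T` becomes `T * lam`.
    have hih := ih (fun E hE => hdet E (by simp [hE])) (fun E hE => hM E (by simp [hE])) (X * D)
      (T * lam) (by positivity) hXD (fun l₁ l₂ e => by
        have := h (D :: l₁) l₂ (by rw [e, List.cons_append])
        rw [List.prod_cons, List.length_cons, pow_succ', ← mul_assoc, ← mul_assoc] at this
        exact this)
    rw [List.prod_cons, ← mul_assoc, ← mul_assoc]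
    rw [← mul_assoc] at hih
    have hT' : T ≤ ‖X‖ ^ 2 := by simpa using h [] (D :: l) rfl
    have hx := norm_pos_of_det_eq_one hX
    have hxd := norm_pos_of_det_eq_one hXD
    have hpl := norm_mul_mul_norm_mul_le A X D
    rw [hX, abs_one, one_mul] at hpl
    have hinv := abs_det_mul_norm_le_left X D
    rw [hD, abs_one, one_mul] at hinv
    have hDM := hM D (by simp)
    have hstep : ‖A * X‖ / ‖X‖ ≤ ‖A * X * D‖ / ‖X * D‖ + ‖A‖ * (M ^ 2 / T) := by
      have e1 : ‖A * X‖ / ‖X‖ ≤ ‖A * X * D‖ / ‖X * D‖ + ‖A‖ * (‖D‖ / (‖X‖ * ‖X * D‖)) := by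
        have : ‖A * X * D‖ / ‖X * D‖ + ‖A‖ * (‖D‖ / (‖X‖ * ‖X * D‖)) =
            (‖A * X * D‖ * ‖X‖ + ‖A‖ * ‖D‖) / (‖X‖ * ‖X * D‖) := by
          field_simp
        rw [this, div_le_div_iff₀ hx (by positivity)]
        nlinarith
      have e2 : ‖D‖ / (‖X‖ * ‖X * D‖) ≤ M ^ 2 / T := by
        rw [div_le_div_iff₀ (by positivity) hT]
        calc ‖D‖ * T ≤ ‖D‖ * ‖X‖ ^ 2 := by gcongr
          _ = ‖D‖ * ‖X‖ * ‖X‖ := by ring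
          _ ≤ ‖D‖ * ‖X‖ * (‖X * D‖ * ‖D‖) := by gcongr
          _ = ‖D‖ ^ 2 * (‖X‖ * ‖X * D‖) := by ring
          _ ≤ M ^ 2 * (‖X‖ * ‖X * D‖) := by gcongr
      have := mul_le_mul_of_nonneg_left e2 (norm_nonneg A)
      linarith
    -- The errors of the single steps form a geometric series of ratio `1 / lam`.
    have e3 : M ^ 2 / T + M ^ 2 * (lam / (lam - 1)) / (T * lam) =
        M ^ 2 * (lam / (lam - 1)) / T := by
      field_simp
      ring
    rw [← e3, mul_add]
    linarith

/-- Mirror image of `norm_mul_div_norm_le`, obtained by transposition. -/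
theorem norm_mul_div_norm_le' {M lam : ℝ} (hlam : 1 < lam) (A : M₂) (l : List M₂)
    (hdet : ∀ D ∈ l, D.det = 1) (hM : ∀ D ∈ l, ‖D‖ ≤ M) (X : M₂) (T : ℝ) (hT : 0 < T)
    (hX : X.det = 1)
    (h : ∀ l₁ l₂, l = l₂ ++ l₁ → T * lam ^ l₁.length ≤ ‖l₁.prod * X‖ ^ 2) :
    ‖X * A‖ / ‖X‖ ≤ ‖l.prod * X * A‖ / ‖l.prod * X‖ +
      ‖A‖ * (M ^ 2 * (lam / (lam - 1)) / T) := by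
  have hn : ∀ Y : M₂, ‖Y.transpose‖ = ‖Y‖ := fun Y => by
    rw [← Matrix.conjTranspose_eq_transpose_of_trivial, Matrix.l2_opNorm_conjTranspose]
  have hp : ∀ k : List M₂, (k.map Matrix.transpose).reverse.prod = k.prod.transpose :=
    fun k => (Matrix.transpose_list_prod k).symm
  have := norm_mul_div_norm_le (M := M) hlam A.transpose (l.map Matrix.transpose).reverse
    (by simpa using hdet) (by simpa [hn] using hM) X.transpose T hT (by simpa using hX)
    (fun l₁ l₂ e => by
      have e' : l = (l₂.map Matrix.transpose).reverse ++ (l₁.map Matrix.transpose).reverse := by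
        have := congrArg (fun k => (k.map Matrix.transpose).reverse) e
        simpa [Function.comp_def] using this
      have := h _ _ e'
      rw [hp, ← hn] at this
      simpa using this)
  rw [hp, ← Matrix.transpose_mul, ← Matrix.transpose_mul, ← Matrix.transpose_mul,
    hn, hn, hn, hn, hn] at this
  rwa [mul_assoc]

/-- Around places of strong cancellation, products of `j` elements of `S` have norm at least
`c * μ ^ j`. -/
def CancellationGrowth (S : Set M₂) (μ c : ℝ) : Prop :=
  ∀ n : ℕ, ∃ ε > 0, ∀ la lb lc : List M₂, (∀ X ∈ la, X ∈ S) → (∀ X ∈ lb, X ∈ S) →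
    (∀ X ∈ lc, X ∈ S) → lb.length ≤ n →
    ‖la.prod * lb.prod * lc.prod‖ ≤ ε * (‖la.prod‖ * ‖lc.prod‖) →
    c * μ ^ lb.length ≤ ‖lb.prod‖

/-- Extending a middle word of length `j` by `k` letters: a short extension still has rate `μ`,
while for a long one `lam ^ k` alone already exceeds `(μ ^ 2) ^ j`. -/
theorem mul_pow_le_sq_of_growth {lam μ c x : ℝ} {j k m n : ℕ} (hlam : 1 < lam) (hμ : lam ≤ μ)
    (hc : 0 < c) (hc1 : c ≤ 1) (hm : μ ^ n ≤ lam ^ m) (hj : j ≤ n)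
    (h1 : k ≤ 2 * m → c * μ ^ (j + k) ≤ x) (h2 : lam ^ (j + k) ≤ x) :
    c ^ 2 * (μ ^ 2) ^ j * lam ^ k ≤ x ^ 2 := by
  have hl0 : 0 < lam := by linarith
  have hμ0 : 0 < μ := by linarith
  have hμ1 : 1 ≤ μ := by linarith
  rcases le_or_gt k (2 * m) with hk | hk
  · calc c ^ 2 * (μ ^ 2) ^ j * lam ^ k ≤ c ^ 2 * (μ ^ 2) ^ j * (μ ^ k * μ ^ k) := by
          gcongr
          calc lam ^ k ≤ μ ^ k := by gcongr
            _ ≤ μ ^ k * μ ^ k := le_mul_of_one_le_right (by positivity) (one_le_pow₀ hμ1)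
      _ = (c * μ ^ (j + k)) ^ 2 := by ring
      _ ≤ x ^ 2 := by gcongr; exact h1 hk
  · have e1 : (μ ^ 2) ^ j ≤ lam ^ k := by
      calc (μ ^ 2) ^ j = (μ ^ j) ^ 2 := by ring
        _ ≤ (μ ^ n) ^ 2 := by gcongr
        _ ≤ (lam ^ m) ^ 2 := by gcongr
        _ = lam ^ (2 * m) := by ring
        _ ≤ lam ^ k := pow_le_pow_right₀ hlam.le hk.le
    calc c ^ 2 * (μ ^ 2) ^ j * lam ^ k ≤ 1 * lam ^ k * lam ^ k := by
          gcongr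
          exact pow_le_one₀ hc.le hc1
      _ = (lam ^ k) ^ 2 := by ring
      _ ≤ (lam ^ (j + k)) ^ 2 := by
          gcongr
          · exact hlam.le
          · omega
      _ ≤ x ^ 2 := by gcongr

/-- Cancellation makes the main terms of `hR` and `hL` negligible, so `‖A * B‖` and `‖B * C‖` are at
most `q ‖B‖` times `‖A‖` and `‖C‖`. Then `abs_det_mul_norm_mul_norm_le` leaves no room for a small
`q ‖B‖`. -/
theorem le_norm_of_cancellation {A B C : M₂} {T κ ε D : ℝ} (dA : A.det = 1) (dB : B.det = 1)
    (dC : C.det = 1) (hT0 : 0 < T) (hκ0 : 0 < κ) (hε : 0 < ε) (hεT : ε * D ≤ 1 / T)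
    (hεD : ε * D ≤ 1 / 2) (hBD : ‖B‖ ≤ D)
    (hR : ‖A * B‖ / ‖B‖ ≤ ‖A * B * C‖ / ‖B * C‖ + ‖A‖ * (κ / T))
    (hL : ‖B * C‖ / ‖B‖ ≤ ‖A * B * C‖ / ‖A * B‖ + ‖C‖ * (κ / T))
    (hcan : ‖A * B * C‖ ≤ ε * (‖A‖ * ‖C‖)) : T / (2 * (κ + 1)) ≤ ‖B‖ := by
  have hA := norm_pos_of_det_eq_one dA
  have hB := norm_pos_of_det_eq_one dB
  have hC := norm_pos_of_det_eq_one dC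
  have hBC : ‖C‖ ≤ ‖B‖ * ‖B * C‖ := by
    simpa [dB] using abs_det_mul_norm_le_right B C
  have hAB : ‖A‖ ≤ ‖A * B‖ * ‖B‖ := by
    simpa [dB] using abs_det_mul_norm_le_left A B
  have hpl := abs_det_mul_norm_mul_norm_le A B C
  rw [dB, abs_one, one_mul] at hpl
  have hBC0 : 0 < ‖B * C‖ := pos_of_mul_pos_right (hC.trans_le hBC) hB.le
  have hAB0 : 0 < ‖A * B‖ := pos_of_mul_pos_left (hA.trans_le hAB) hB.le
  set q := (κ + 1) / T with hq
  have hq' : q = κ / T + 1 / T := by rw [hq, add_div]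
  have bAB : ‖A * B‖ ≤ ‖A‖ * q * ‖B‖ := by
    rw [← div_le_iff₀ hB, hq', mul_add, add_comm]
    refine hR.trans (add_le_add_left ?_ _)
    rw [div_le_iff₀ hBC0]
    calc ‖A * B * C‖ ≤ ε * (‖A‖ * ‖C‖) := hcan
      _ ≤ ε * (‖A‖ * (D * ‖B * C‖)) := by
        gcongr
        exact hBC.trans (by gcongr)
      _ = ‖A‖ * (ε * D) * ‖B * C‖ := by ring
      _ ≤ ‖A‖ * (1 / T) * ‖B * C‖ := by gcongr
  have bBC : ‖B * C‖ ≤ ‖C‖ * q * ‖B‖ := by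
    rw [← div_le_iff₀ hB, hq', mul_add, add_comm]
    refine hL.trans (add_le_add_left ?_ _)
    rw [div_le_iff₀ hAB0]
    calc ‖A * B * C‖ ≤ ε * (‖A‖ * ‖C‖) := hcan
      _ ≤ ε * (‖A * B‖ * D * ‖C‖) := by
        gcongr
        exact hAB.trans (by gcongr)
      _ = ‖C‖ * (ε * D) * ‖A * B‖ := by ring
      _ ≤ ‖C‖ * (1 / T) * ‖A * B‖ := by gcongr
  have hfin : ‖A‖ * ‖C‖ ≤ ‖A‖ * ‖C‖ * ((q * ‖B‖) ^ 2 + 1 / 2) := by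
    calc ‖A‖ * ‖C‖ ≤ ‖A * B‖ * ‖B * C‖ + ‖A * B * C‖ * ‖B‖ := hpl
      _ ≤ (‖A‖ * q * ‖B‖) * (‖C‖ * q * ‖B‖) + ε * (‖A‖ * ‖C‖) * D := by gcongr
      _ = ‖A‖ * ‖C‖ * ((q * ‖B‖) ^ 2 + ε * D) := by ring
      _ ≤ _ := by gcongr
  have hfin' : 1 ≤ (q * ‖B‖) ^ 2 + 1 / 2 := by
    by_contra hlt
    have := mul_lt_mul_of_pos_left (not_le.1 hlt) (mul_pos hA hC)
    linarith
  have hqB : 1 / 2 ≤ q * ‖B‖ := by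
    by_contra hlt
    have h0 : 0 ≤ q * ‖B‖ := by positivity
    nlinarith
  rw [hq, div_mul_eq_mul_div, le_div_iff₀ hT0] at hqB
  rw [div_le_iff₀ (by positivity)]
  linarith

/-- The rate doubles in the exponent because the prefix bounds concern squared norms, while
`le_norm_of_cancellation` bounds `‖B‖` itself below by a multiple of the same `T`. -/
theorem CancellationGrowth.sq {S : Set M₂} {lam M μ c : ℝ} (hdet : ∀ X ∈ S, X.det = 1)
    (hM1 : 1 ≤ M) (hM : ∀ X ∈ S, ‖X‖ ≤ M) (hlam : 1 < lam)
    (hgrow : ∀ l : List M₂, (∀ X ∈ l, X ∈ S) → lam ^ l.length ≤ ‖l.prod‖)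
    (hμ : lam ≤ μ) (hc : 0 < c) (hc1 : c ≤ 1) (h : CancellationGrowth S μ c) :
    CancellationGrowth S (μ ^ 2) (c ^ 2 / (2 * (M ^ 2 * (lam / (lam - 1)) + 1))) := by
  intro n
  have hl0 : 0 < lam := by linarith
  have hl1 : 0 < lam - 1 := by linarith
  have hμ0 : 0 < μ := by linarith
  have hμ1 : 1 ≤ μ := by linarith
  have hM0 : 0 < M := by linarith
  set κ := M ^ 2 * (lam / (lam - 1)) with hκ
  have hκ0 : 0 < κ := by positivity
  obtain ⟨m, hm⟩ := pow_unbounded_of_one_lt (μ ^ n) hlam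
  obtain ⟨ε₀, hε₀, H⟩ := h (n + 2 * m)
  -- The first entry pays for moving up to `2 * m` outer factors into the middle word; the second
  -- makes `ε * M ^ n` at most both `1 / T` and `1 / 2`.
  refine ⟨min (ε₀ / M ^ (2 * m)) (1 / (2 * (M ^ n * (μ ^ 2) ^ n))), by positivity, ?_⟩
  intro la lb lc hla hlb hlc hn hcan
  set ε := min (ε₀ / M ^ (2 * m)) (1 / (2 * (M ^ n * (μ ^ 2) ^ n)))
  have hεpos : 0 < ε := by positivity
  have hε1 : ε * M ^ (2 * m) ≤ ε₀ := by
    rw [← le_div_iff₀ (by positivity)]; exact min_le_left _ _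
  have hε2 : ε * M ^ n * (μ ^ 2) ^ n ≤ 1 / 2 := by
    have : ε ≤ 1 / (2 * (M ^ n * (μ ^ 2) ^ n)) := min_le_right _ _
    rw [le_div_iff₀ (by positivity)] at this
    linarith
  have hone : ∀ l : List M₂, (∀ X ∈ l, X ∈ S) → l.prod.det = 1 := fun l hl =>
    det_list_prod_eq_one fun X hX => hdet X (hl X hX)
  have hbd : ∀ l : List M₂, (∀ X ∈ l, X ∈ S) → ‖l.prod‖ ≤ M ^ l.length := fun l hl =>
    norm_list_prod_le_pow hM1 fun X hX => hM X (hl X hX)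
  set j := lb.length with hj
  set T := c ^ 2 * (μ ^ 2) ^ j with hT
  have hT0 : 0 < T := by positivity
  have hTn : T ≤ (μ ^ 2) ^ n := by
    calc T ≤ 1 * (μ ^ 2) ^ n := by
          rw [hT]
          gcongr
          · exact pow_le_one₀ hc.le hc1
          · exact one_le_pow₀ hμ1
      _ = _ := one_mul _
  have hright : ∀ l₁ l₂, lc = l₁ ++ l₂ → T * lam ^ l₁.length ≤ ‖lb.prod * l₁.prod‖ ^ 2 := by
    rintro l₁ l₂ rfl
    have h₁ : ∀ X ∈ l₁, X ∈ S := fun X hX => hlc X (by simp [hX])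
    have h₂ : ∀ X ∈ l₂, X ∈ S := fun X hX => hlc X (by simp [hX])
    have h₃ : ∀ X ∈ lb ++ l₁, X ∈ S := fun X hX => (List.mem_append.1 hX).elim (hlb X) (h₁ X)
    refine mul_pow_le_sq_of_growth hlam hμ hc hc1 hm.le hn (fun hk => ?_) ?_
    · have := H la (lb ++ l₁) l₂ hla h₃ h₂ (by rw [List.length_append]; omega) (by
        rw [List.prod_append] at hcan ⊢
        rw [mul_assoc, mul_assoc lb.prod, ← mul_assoc la.prod]
        refine hcan.trans ?_
        calc ε * (‖la.prod‖ * ‖l₁.prod * l₂.prod‖)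
            ≤ ε * (‖la.prod‖ * (M ^ (2 * m) * ‖l₂.prod‖)) := by
              gcongr
              refine (norm_mul_le _ _).trans ?_
              gcongr
              exact (hbd l₁ h₁).trans (pow_le_pow_right₀ hM1 hk)
          _ = ε * M ^ (2 * m) * (‖la.prod‖ * ‖l₂.prod‖) := by ring
          _ ≤ ε₀ * (‖la.prod‖ * ‖l₂.prod‖) := by gcongr)
      rwa [List.length_append, List.prod_append] at this
    · have := hgrow _ h₃
      rwa [List.length_append, List.prod_append] at this
  have hleft : ∀ l₁ l₂, la = l₂ ++ l₁ → T * lam ^ l₁.length ≤ ‖l₁.prod * lb.prod‖ ^ 2 := by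
    rintro l₁ l₂ rfl
    have h₁ : ∀ X ∈ l₁, X ∈ S := fun X hX => hla X (by simp [hX])
    have h₂ : ∀ X ∈ l₂, X ∈ S := fun X hX => hla X (by simp [hX])
    have h₃ : ∀ X ∈ l₁ ++ lb, X ∈ S := fun X hX => (List.mem_append.1 hX).elim (h₁ X) (hlb X)
    refine mul_pow_le_sq_of_growth hlam hμ hc hc1 hm.le hn (fun hk => ?_) ?_
    · have := H l₂ (l₁ ++ lb) lc h₂ h₃ hlc (by rw [List.length_append]; omega) (by
        rw [List.prod_append] at hcan ⊢
        rw [← mul_assoc l₂.prod]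
        refine hcan.trans ?_
        calc ε * (‖l₂.prod * l₁.prod‖ * ‖lc.prod‖)
            ≤ ε * (‖l₂.prod‖ * M ^ (2 * m) * ‖lc.prod‖) := by
              gcongr
              refine (norm_mul_le _ _).trans ?_
              gcongr
              exact (hbd l₁ h₁).trans (pow_le_pow_right₀ hM1 hk)
          _ = ε * M ^ (2 * m) * (‖l₂.prod‖ * ‖lc.prod‖) := by ring
          _ ≤ ε₀ * (‖l₂.prod‖ * ‖lc.prod‖) := by gcongr)
      rwa [List.length_append, List.prod_append, add_comm] at this
    · have := hgrow _ h₃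
      rwa [List.length_append, List.prod_append, add_comm] at this
  have hBn : ‖lb.prod‖ ≤ M ^ n := (hbd lb hlb).trans (pow_le_pow_right₀ hM1 hn)
  have hR := norm_mul_div_norm_le (M := M) hlam la.prod lc (fun X hX => hdet X (hlc X hX))
    (fun X hX => hM X (hlc X hX)) lb.prod T hT0 (hone lb hlb) hright
  have hL := norm_mul_div_norm_le' (M := M) hlam lc.prod la (fun X hX => hdet X (hla X hX))
    (fun X hX => hM X (hla X hX)) lb.prod T hT0 (hone lb hlb) hleft
  have hεT : ε * M ^ n ≤ 1 / T := by
    rw [le_div_iff₀ hT0]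
    calc ε * M ^ n * T ≤ ε * M ^ n * (μ ^ 2) ^ n := by gcongr
      _ ≤ 1 := by linarith
  have hεM : ε * M ^ n ≤ 1 / 2 := by
    refine le_trans ?_ hε2
    exact le_mul_of_one_le_right (by positivity) (one_le_pow₀ (one_le_pow₀ hμ1))
  have := le_norm_of_cancellation (hone la hla) (hone lb hlb) (hone lc hlc) hT0 hκ0 hεpos
    hεT hεM hBn hR hL hcan
  rw [div_mul_eq_mul_div, ← hT]
  exact this

theorem exists_cancellationGrowth {S : Set M₂} {lam M : ℝ} (hdet : ∀ X ∈ S, X.det = 1)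
    (hM1 : 1 ≤ M) (hM : ∀ X ∈ S, ‖X‖ ≤ M) (hlam : 1 < lam)
    (hgrow : ∀ l : List M₂, (∀ X ∈ l, X ∈ S) → lam ^ l.length ≤ ‖l.prod‖) (i : ℕ) :
    ∃ c : ℝ, 0 < c ∧ c ≤ 1 ∧ CancellationGrowth S (lam ^ 2 ^ i) c := by
  induction i with
  | zero =>
    refine ⟨1, one_pos, le_rfl, fun n => ⟨1, one_pos, fun la lb lc _ hlb _ _ _ => ?_⟩⟩
    simpa using hgrow lb hlb
  | succ i ih =>
    obtain ⟨c, hc, hc1, h⟩ := ih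
    have hl0 : 0 < lam := by linarith
    have hl1 : 0 < lam - 1 := by linarith
    have hκ : 0 < M ^ 2 * (lam / (lam - 1)) := by positivity
    refine ⟨_, ?_, ?_, by
      rw [pow_succ 2, pow_mul]
      exact h.sq hdet hM1 hM hlam hgrow (le_self_pow₀ hlam.le (by positivity)) hc hc1⟩
    · positivity
    · rw [div_le_one (by positivity)]
      nlinarith

/-- Uniform exponential growth of products in `SL₂` implies that norms are almost
multiplicative. -/
theorem exists_mul_norm_mul_norm_le_norm_mul {S : Set M₂} {lam M : ℝ}
    (hdet : ∀ X ∈ S, X.det = 1) (hM1 : 1 ≤ M) (hM : ∀ X ∈ S, ‖X‖ ≤ M) (hlam : 1 < lam)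
    (hgrow : ∀ l : List M₂, (∀ X ∈ l, X ∈ S) → lam ^ l.length ≤ ‖l.prod‖) :
    ∃ c > 0, ∀ la lb : List M₂, (∀ X ∈ la, X ∈ S) → (∀ X ∈ lb, X ∈ S) →
      c * (‖la.prod‖ * ‖lb.prod‖) ≤ ‖la.prod * lb.prod‖ := by
  have hM0 : 0 < M := by linarith
  -- After `i` squarings the rate exceeds `M`, so words of a suitable length `n` are too small to
  -- sit at a strong cancellation.
  obtain ⟨i, hi⟩ := pow_unbounded_of_one_lt M hlam
  obtain ⟨c, hc, -, h⟩ := exists_cancellationGrowth hdet hM1 hM hlam hgrow i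
  have hμ : M < lam ^ 2 ^ i :=
    hi.trans_le (pow_le_pow_right₀ hlam.le Nat.lt_two_pow_self.le)
  obtain ⟨n, hn⟩ := pow_unbounded_of_one_lt (1 / c) ((one_lt_div hM0).2 hμ)
  rw [div_pow, div_lt_div_iff₀ hc (by positivity), one_mul] at hn
  obtain ⟨ε, hε, H⟩ := h n
  have hbd : ∀ l : List M₂, (∀ X ∈ l, X ∈ S) → ‖l.prod‖ ≤ M ^ l.length := fun l hl =>
    norm_list_prod_le_pow hM1 fun X hX => hM X (hl X hX)
  refine ⟨min (ε / M ^ n) (1 / (M ^ n * M ^ n)), by positivity, fun la lb hla hlb => ?_⟩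
  rcases le_total n la.length with hlen | hlen
  · set l₁ := la.take (la.length - n) with hl₁
    set l₂ := la.drop (la.length - n) with hl₂
    have e : la = l₁ ++ l₂ := (List.take_append_drop _ _).symm
    have h₁ : ∀ X ∈ l₁, X ∈ S := fun X hX => hla X (List.mem_of_mem_take hX)
    have h₂ : ∀ X ∈ l₂, X ∈ S := fun X hX => hla X (List.mem_of_mem_drop hX)
    have hlen₂ : l₂.length = n := by rw [hl₂, List.length_drop]; omega
    have hb₂ := hbd l₂ h₂
    rw [hlen₂] at hb₂
    -- Otherwise the middle word `l₂` would have norm at least `c * (lam ^ 2 ^ i) ^ n`, which is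
    -- more than `M ^ n`.
    have hlow : ε * (‖l₁.prod‖ * ‖lb.prod‖) ≤ ‖l₁.prod * l₂.prod * lb.prod‖ := by
      by_contra hlt
      have := H l₁ l₂ lb h₁ h₂ hlb hlen₂.le (not_le.1 hlt).le
      rw [hlen₂] at this
      linarith
    rw [e, List.prod_append]
    refine le_trans ?_ hlow
    calc _ ≤ ε / M ^ n * ((‖l₁.prod‖ * M ^ n) * ‖lb.prod‖) := by
          gcongr
          · exact min_le_left _ _
          · exact (norm_mul_le _ _).trans (by gcongr)
      _ = _ := by field_simp
  · have hb := (hbd la hla).trans (pow_le_pow_right₀ hM1 hlen)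
    have hd : la.prod.det = 1 := det_list_prod_eq_one fun X hX => hdet X (hla X hX)
    have hinv := abs_det_mul_norm_le_right la.prod lb.prod
    rw [hd, abs_one, one_mul] at hinv
    calc _ ≤ 1 / (M ^ n * M ^ n) * (M ^ n * (M ^ n * ‖la.prod * lb.prod‖)) := by
          gcongr
          · exact min_le_right _ _
          · exact hinv.trans (by gcongr)
      _ = _ := by field_simp

/-! ### From local to global non-cancellation. -/

/-- If neighbouring factors do not cancel and all factors are sufficiently hyperbolic, then no
cancellation occurs in long products. -/
theorem half_mul_norm_mul_norm_le_norm_mul_list_prod {T : Set M₂} {c : ℝ} (hc : 0 < c)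
    (hc2 : c ≤ 2) (hpos : ∀ X ∈ T, 0 < ‖X‖) (hdet : ∀ X ∈ T, |X.det| ≤ c ^ 2 / 4 * ‖X‖ ^ 2)
    (hmul : ∀ X ∈ T, ∀ Y ∈ T, c * (‖X‖ * ‖Y‖) ≤ ‖X * Y‖) (l : List M₂) :
    (∀ Y ∈ l, Y ∈ T) → ∀ X ∈ T, c / 2 * (‖X‖ * ‖l.prod‖) ≤ ‖X * l.prod‖ := by
  induction l with
  | nil =>
    intro _ X _
    rw [List.prod_nil, norm_one, mul_one, mul_one]
    nlinarith [norm_nonneg X]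
  | cons Y l ih =>
    intro hl X hX
    have hY : Y ∈ T := hl Y (by simp)
    have hih := ih (fun Z hZ => hl Z (by simp [hZ])) Y hY
    have hXY := hmul X hX Y hY
    have hpl := norm_mul_mul_norm_mul_le X Y l.prod
    have hY0 := hpos Y hY
    have hdY := hdet Y hY
    rw [List.prod_cons, ← mul_assoc X]
    -- By induction the determinant term consumes at most half of the constant `c`, so the loss does
    -- not accumulate.
    have h1 : |Y.det| * (‖X‖ * ‖l.prod‖) ≤ c / 2 * ‖Y‖ * ‖X‖ * ‖Y * l.prod‖ := by
      calc |Y.det| * (‖X‖ * ‖l.prod‖) ≤ c ^ 2 / 4 * ‖Y‖ ^ 2 * (‖X‖ * ‖l.prod‖) := by gcongr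
        _ = c / 2 * ‖Y‖ * ‖X‖ * (c / 2 * (‖Y‖ * ‖l.prod‖)) := by ring
        _ ≤ _ := by gcongr
    have h2 := mul_le_mul_of_nonneg_right hXY (norm_nonneg (Y * l.prod))
    refine le_of_mul_le_mul_right ?_ hY0
    linarith

theorem pow_length_le_norm_list_prod {T : Set M₂} {c t : ℝ} (hc : 0 < c)
    (hc2 : c ≤ 2) (ht : 0 < t) (hT : ∀ X ∈ T, t ≤ ‖X‖)
    (hdet : ∀ X ∈ T, |X.det| ≤ c ^ 2 / 4 * ‖X‖ ^ 2)
    (hmul : ∀ X ∈ T, ∀ Y ∈ T, c * (‖X‖ * ‖Y‖) ≤ ‖X * Y‖) (l : List M₂) (hl : ∀ Y ∈ l, Y ∈ T) :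
    (c / 2 * t) ^ l.length ≤ ‖l.prod‖ := by
  induction l with
  | nil => simp
  | cons Y l ih =>
    have hY : Y ∈ T := hl Y (by simp)
    have hl' : ∀ Z ∈ l, Z ∈ T := fun Z hZ => hl Z (by simp [hZ])
    have h := half_mul_norm_mul_norm_le_norm_mul_list_prod hc hc2
      (fun X hX => ht.trans_le (hT X hX)) hdet hmul l hl' Y hY
    rw [List.prod_cons, List.length_cons, pow_succ']
    refine le_trans ?_ h
    rw [← mul_assoc]
    gcongr
    · exact hT Y hY
    · exact ih hl'

/-! ### Products of fixed length and the lower spectral radius. -/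

section Products

variable {d : ℕ} {S : Set (Matrix (Fin d) (Fin d) ℝ)}

theorem matrixProducts_add {m n : ℕ} {P : Matrix (Fin d) (Fin d) ℝ}
    (hP : P ∈ matrixProducts S (m + n)) :
    ∃ Q ∈ matrixProducts S m, ∃ R ∈ matrixProducts S n, Q * R = P := by
  obtain ⟨l, hl, hS, rfl⟩ := hP
  refine ⟨_, ⟨l.take m, by simp [hl], fun X hX => hS X (List.mem_of_mem_take hX), rfl⟩,
    _, ⟨l.drop m, by simp [hl], fun X hX => hS X (List.mem_of_mem_drop hX), rfl⟩, ?_⟩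
  rw [← List.prod_append, List.take_append_drop]

theorem matrixProducts_mul_subset (N n : ℕ) :
    matrixProducts S (n * N) ⊆ matrixProducts (matrixProducts S N) n := by
  induction n with
  | zero =>
    rintro P ⟨l, hl, -, rfl⟩
    rw [zero_mul, List.length_eq_zero_iff] at hl
    exact ⟨[], rfl, by simp, by rw [hl]⟩
  | succ n ih =>
    intro P hP
    rw [Nat.succ_mul, add_comm] at hP
    obtain ⟨Q, hQ, R, hR, rfl⟩ := matrixProducts_add hP
    obtain ⟨l, hl, hS, rfl⟩ := ih hR
    exact ⟨Q :: l, by simp [hl], by simpa using ⟨hQ, hS⟩, by simp⟩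

theorem pow_mem_matrixProducts {n : ℕ} {P : Matrix (Fin d) (Fin d) ℝ}
    (hP : P ∈ matrixProducts S n) (N : ℕ) : P ^ N ∈ matrixProducts S (n * N) := by
  obtain ⟨l, hl, hS, rfl⟩ := hP
  refine ⟨(List.replicate N l).flatten, by simp [hl, mul_comm], ?_, by simp [List.prod_flatten]⟩
  intro X hX
  obtain ⟨k, hk, hXk⟩ := List.mem_flatten.1 hX
  rw [List.eq_of_mem_replicate hk] at hXk
  exact hS X hXk

theorem mem_matrixProducts_iff_ofFn {n : ℕ} {P : Matrix (Fin d) (Fin d) ℝ} :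
    P ∈ matrixProducts S n ↔
      ∃ f : Fin n → Matrix (Fin d) (Fin d) ℝ, (∀ i, f i ∈ S) ∧ (List.ofFn f).prod = P := by
  constructor
  · rintro ⟨l, rfl, hS, rfl⟩
    exact ⟨l.get, fun i => hS _ (l.get_mem i), by rw [List.ofFn_get]⟩
  · rintro ⟨f, hf, rfl⟩
    exact ⟨List.ofFn f, List.length_ofFn, by simpa [List.mem_ofFn] using hf, rfl⟩

theorem continuous_ofFn_prod (n : ℕ) :
    Continuous fun f : Fin n → Matrix (Fin d) (Fin d) ℝ => (List.ofFn f).prod := by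
  simp only [List.ofFn_eq_map]
  exact continuous_list_prod _ fun i _ => continuous_apply i

theorem lowerSpectralRadius_le {n : ℕ} (hn : 1 ≤ n) {P : Matrix (Fin d) (Fin d) ℝ}
    (hP : P ∈ matrixProducts S n) : lowerSpectralRadius S ≤ ‖P‖ ^ (1 / (n : ℝ)) :=
  csInf_le ⟨0, by rintro _ ⟨n, -, P, -, rfl⟩; positivity⟩ ⟨n, hn, P, hP, rfl⟩

theorem exists_norm_rpow_lt {b : ℝ} (hS : S.Nonempty) (hb : lowerSpectralRadius S < b) :
    ∃ n : ℕ, 1 ≤ n ∧ ∃ P ∈ matrixProducts S n, ‖P‖ ^ (1 / (n : ℝ)) < b := by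
  obtain ⟨R, hR⟩ := hS
  obtain ⟨_, ⟨n, hn, P, hP, rfl⟩, h⟩ := exists_lt_of_csInf_lt
    (⟨_, 1, le_rfl, R, ⟨[R], by simp [hR]⟩, rfl⟩ : {r : ℝ | ∃ n : ℕ, 1 ≤ n ∧
      ∃ P ∈ matrixProducts S n, r = ‖P‖ ^ (1 / (n : ℝ))}.Nonempty) hb
  exact ⟨n, hn, P, hP, h⟩

theorem lowerSpectralRadius_nonneg (S : Set (Matrix (Fin d) (Fin d) ℝ)) :
    0 ≤ lowerSpectralRadius S :=
  Real.sInf_nonneg (by rintro _ ⟨n, -, P, -, rfl⟩; positivity)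

theorem le_rpow_one_div_iff_pow_le {a x : ℝ} (ha : 0 ≤ a) (hx : 0 ≤ x) {n : ℕ} (hn : 1 ≤ n) :
    a ≤ x ^ (1 / (n : ℝ)) ↔ a ^ n ≤ x := by
  rw [one_div, Real.le_rpow_inv_iff_of_pos ha hx (by positivity), Real.rpow_natCast]

theorem lowerSpectralRadius_pow_le_norm (l : List (Matrix (Fin d) (Fin d) ℝ))
    (hl : ∀ X ∈ l, X ∈ S) (hne : l ≠ []) : lowerSpectralRadius S ^ l.length ≤ ‖l.prod‖ := by
  have h1 : 1 ≤ l.length := List.length_pos_iff.2 hne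
  exact (le_rpow_one_div_iff_pow_le (lowerSpectralRadius_nonneg S) (norm_nonneg _) h1).1
    (lowerSpectralRadius_le h1 ⟨l, rfl, hl, rfl⟩)

theorem le_lowerSpectralRadius {a : ℝ} (hS : S.Nonempty) (ha : 0 ≤ a)
    (h : ∀ n, 1 ≤ n → ∀ P ∈ matrixProducts S n, a ^ n ≤ ‖P‖) : a ≤ lowerSpectralRadius S := by
  by_contra hlt
  obtain ⟨n, hn, P, hP, hPa⟩ := exists_norm_rpow_lt hS (not_le.1 hlt)
  exact absurd ((le_rpow_one_div_iff_pow_le ha (norm_nonneg _) hn).2 (h n hn P hP))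
    (not_le.2 hPa)

/-- It suffices to bound the products of blocks of length `N`. -/
theorem le_lowerSpectralRadius_of_blocks {a : ℝ} (hS : S.Nonempty) (ha : 0 ≤ a) {N : ℕ}
    (hN : 1 ≤ N)
    (h : ∀ l : List (Matrix (Fin d) (Fin d) ℝ), (∀ X ∈ l, X ∈ matrixProducts S N) →
      (a ^ N) ^ l.length ≤ ‖l.prod‖) : a ≤ lowerSpectralRadius S := by
  refine le_lowerSpectralRadius hS ha fun n _ P hP => ?_
  -- `N` need not divide `n`, but `P ^ N` always splits into `n` blocks of length `N`.
  obtain ⟨l, hl, hlT, hlP⟩ := matrixProducts_mul_subset N n (pow_mem_matrixProducts hP N)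
  have h1 := h l hlT
  rw [hl, hlP] at h1
  have h2 : (a ^ n) ^ N ≤ ‖P‖ ^ N := by
    calc (a ^ n) ^ N = (a ^ N) ^ n := by ring
      _ ≤ ‖P ^ N‖ := h1
      _ ≤ ‖P‖ ^ N := norm_pow_le' P (by omega)
  exact le_of_pow_le_pow_left₀ (by omega) (norm_nonneg _) h2

end Products

/-! ### Stability of conditions on tuples under Hausdorff perturbation. -/

section Hausdorff

variable {α ι : Type*} [MetricSpace α] [Fintype ι]

theorem eventually_forall_pi_mem (K₀ : NonemptyCompacts α) {U : Set (ι → α)} (hU : IsOpen U)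
    (h : ∀ f : ι → α, (∀ i, f i ∈ K₀) → f ∈ U) :
    ∀ᶠ K in 𝓝 K₀, ∀ f : ι → α, (∀ i, f i ∈ K) → f ∈ U := by
  have hcomp : IsCompact (Set.univ.pi fun _ : ι => (K₀ : Set α)) :=
    isCompact_univ_pi fun _ => K₀.isCompact
  obtain ⟨δ, hδ, hδU⟩ := hcomp.exists_thickening_subset_open hU fun f hf =>
    h f fun i => hf i trivial
  filter_upwards [Metric.ball_mem_nhds K₀ hδ] with K hK f hf
  rw [Metric.mem_ball, Metric.NonemptyCompacts.dist_eq] at hK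
  have hne := Metric.hausdorffEDist_ne_top_of_nonempty_of_bounded K.nonempty K₀.nonempty
    K.isCompact.isBounded K₀.isCompact.isBounded
  choose g hg hfg using fun i => Metric.exists_dist_lt_of_hausdorffDist_lt (hf i) hK hne
  exact hδU (Metric.mem_thickening_iff.2 ⟨g, fun i _ => hg i, (dist_pi_lt_iff hδ).2 hfg⟩)

theorem eventually_exists_pi_mem (K₀ : NonemptyCompacts α) {U : Set (ι → α)} {f₀ : ι → α}
    (hU : U ∈ 𝓝 f₀) (hf₀ : ∀ i, f₀ i ∈ K₀) :
    ∀ᶠ K in 𝓝 K₀, ∃ f : ι → α, (∀ i, f i ∈ K) ∧ f ∈ U := by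
  obtain ⟨δ, hδ, hδU⟩ := Metric.mem_nhds_iff.1 hU
  filter_upwards [Metric.ball_mem_nhds K₀ hδ] with K hK
  rw [Metric.mem_ball', Metric.NonemptyCompacts.dist_eq] at hK
  have hne := Metric.hausdorffEDist_ne_top_of_nonempty_of_bounded K₀.nonempty K.nonempty
    K₀.isCompact.isBounded K.isCompact.isBounded
  choose g hg hfg using fun i => Metric.exists_dist_lt_of_hausdorffDist_lt (hf₀ i) hK hne
  exact ⟨g, hg, hδU (Metric.mem_ball'.2 ((dist_pi_lt_iff hδ).2 hfg))⟩

end Hausdorff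

/-! ### Semicontinuity and the conclusion. -/

/-- One product witnessing the bound persists when its factors are perturbed. -/
theorem eventually_lowerSpectralRadius_lt {d : ℕ}
    (K₀ : NonemptyCompacts (Matrix (Fin d) (Fin d) ℝ)) {b : ℝ}
    (hb : lowerSpectralRadius (K₀ : Set (Matrix (Fin d) (Fin d) ℝ)) < b) :
    ∀ᶠ K : NonemptyCompacts (Matrix (Fin d) (Fin d) ℝ) in 𝓝 K₀,
      lowerSpectralRadius (K : Set (Matrix (Fin d) (Fin d) ℝ)) < b := by
  obtain ⟨n, hn, P, hP, hPb⟩ := exists_norm_rpow_lt K₀.nonempty hb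
  obtain ⟨f₀, hf₀, rfl⟩ := mem_matrixProducts_iff_ofFn.1 hP
  have hcont : Continuous fun f : Fin n → Matrix (Fin d) (Fin d) ℝ =>
      ‖(List.ofFn f).prod‖ ^ (1 / (n : ℝ)) :=
    (continuous_ofFn_prod n).norm.rpow_const fun _ => Or.inr (by positivity)
  filter_upwards [eventually_exists_pi_mem K₀
    ((isOpen_lt hcont continuous_const).mem_nhds hPb) hf₀] with K ⟨f, hf, hfb⟩
  exact (lowerSpectralRadius_le hn (mem_matrixProducts_iff_ofFn.2 ⟨f, hf, rfl⟩)).trans_lt hfb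

theorem pow_le_abs_det_list_prod {b : ℝ} (hb : 0 ≤ b) (l : List M₂) (h : ∀ X ∈ l, b ≤ |X.det|) :
    b ^ l.length ≤ |l.prod.det| := by
  induction l with
  | nil => simp
  | cons X l ih =>
    rw [List.prod_cons, List.length_cons, pow_succ', Matrix.det_mul, abs_mul]
    gcongr
    · exact h X (by simp)
    · exact ih fun Y hY => h Y (by simp [hY])

theorem eventually_le_lowerSpectralRadius_of_lt_one (K₀ : NonemptyCompacts M₂)
    (hdet : ∀ X ∈ K₀, X.det = 1) {a : ℝ} (ha0 : 0 ≤ a) (ha : a < 1) :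
    ∀ᶠ K : NonemptyCompacts M₂ in 𝓝 K₀, a ≤ lowerSpectralRadius (K : Set M₂) := by
  have hopen : IsOpen {f : Unit → M₂ | a ^ 2 < |(f ()).det|} :=
    isOpen_lt continuous_const ((continuous_apply ()).matrix_det.abs)
  filter_upwards [eventually_forall_pi_mem K₀ hopen fun f hf => by
    rw [Set.mem_ofPred_eq, hdet _ (hf ()), abs_one]
    nlinarith] with K hK
  refine le_lowerSpectralRadius K.nonempty ha0 ?_
  rintro n - _ ⟨l, rfl, hl, rfl⟩
  have h := (pow_le_abs_det_list_prod (by positivity) l fun X hX =>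
    (hK (fun _ => X) fun _ => hl X hX).le).trans (abs_det_le_sq_norm l.prod)
  rw [← pow_mul, mul_comm, pow_mul] at h
  exact le_of_pow_le_pow_left₀ two_ne_zero (norm_nonneg _) h

theorem eventually_le_lowerSpectralRadius_of_one_lt (K₀ : NonemptyCompacts M₂)
    (hdet : ∀ X ∈ K₀, X.det = 1) (hlam : 1 < lowerSpectralRadius (K₀ : Set M₂)) {a : ℝ}
    (ha0 : 0 < a) (ha : a < lowerSpectralRadius (K₀ : Set M₂)) :
    ∀ᶠ K : NonemptyCompacts M₂ in 𝓝 K₀, a ≤ lowerSpectralRadius (K : Set M₂) := by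
  set lam := lowerSpectralRadius (K₀ : Set M₂)
  have hgrow : ∀ l : List M₂, (∀ X ∈ l, X ∈ (K₀ : Set M₂)) → lam ^ l.length ≤ ‖l.prod‖ := by
    intro l hl
    rcases eq_or_ne l [] with rfl | hne
    · simp
    · exact lowerSpectralRadius_pow_le_norm l hl hne
  obtain ⟨M, hM⟩ := K₀.isCompact.isBounded.exists_norm_le
  obtain ⟨c₀, hc₀, hmul₀⟩ := exists_mul_norm_mul_norm_le_norm_mul (S := (K₀ : Set M₂))
    (M := max M 1) hdet (le_max_right _ _) (fun X hX => (hM X hX).trans (le_max_left _ _)) hlam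
    hgrow
  -- Halving `c₀` makes the inequality strict, hence open; the cap 2 serves the empty product.
  set c := min (c₀ / 2) 2
  have hc : 0 < c := by positivity
  have hc2 : c ≤ 2 := min_le_right _ _
  have hcc : c < c₀ := (min_le_left _ _).trans_lt (by linarith)
  have hmul : ∀ {l k : List M₂}, (∀ X ∈ l, X ∈ K₀) → (∀ X ∈ k, X ∈ K₀) →
      c * (‖l.prod‖ * ‖k.prod‖) < ‖l.prod * k.prod‖ := by
    intro l k hl hk
    refine lt_of_lt_of_le ?_ (hmul₀ l k hl hk)
    have h1 := norm_pos_of_det_eq_one (det_list_prod_eq_one fun X hX => hdet X (hl X hX))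
    have h2 := norm_pos_of_det_eq_one (det_list_prod_eq_one fun X hX => hdet X (hk X hX))
    gcongr
  obtain ⟨b, hab, hbl⟩ := exists_between (max_lt ha hlam)
  have hab' : a < b := (le_max_left _ _).trans_lt hab
  have hb1 : 1 < b := (le_max_right _ _).trans_lt hab
  -- The gap between `a` and `b` absorbs the factor `c / 2` lost per block, and the last condition
  -- makes determinant one small against the squared norm of a block.
  obtain ⟨N, hN1, hNa, hNb⟩ : ∃ N : ℕ, 1 ≤ N ∧ 2 / c < (b / a) ^ N ∧ 4 / c ^ 2 < b ^ N :=
    ((eventually_ge_atTop 1).and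
      (((tendsto_pow_atTop_atTop_of_one_lt ((one_lt_div ha0).2 hab')).eventually_gt_atTop _).and
      ((tendsto_pow_atTop_atTop_of_one_lt hb1).eventually_gt_atTop _))).exists
  have hNa' : a ^ N ≤ c / 2 * b ^ N := by
    rw [div_pow, div_lt_div_iff₀ hc (by positivity)] at hNa
    linarith
  have hprod := continuous_ofFn_prod (d := 2) N
  have hopen₁ : IsOpen {f : Fin N → M₂ | b ^ N < ‖(List.ofFn f).prod‖} :=
    isOpen_lt continuous_const hprod.norm
  have hopen₂ : IsOpen {f : Fin N → M₂ |
      |(List.ofFn f).prod.det| < c ^ 2 / 4 * ‖(List.ofFn f).prod‖ ^ 2} :=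
    isOpen_lt hprod.matrix_det.abs (continuous_const.mul (hprod.norm.pow 2))
  -- The sum type encodes a pair of blocks as one tuple.
  have hl : Continuous fun f : Fin N ⊕ Fin N → M₂ => (List.ofFn (f ∘ Sum.inl)).prod :=
    hprod.comp (continuous_pi fun i => continuous_apply (Sum.inl i))
  have hr : Continuous fun f : Fin N ⊕ Fin N → M₂ => (List.ofFn (f ∘ Sum.inr)).prod :=
    hprod.comp (continuous_pi fun i => continuous_apply (Sum.inr i))
  have hopen₃ : IsOpen {f : Fin N ⊕ Fin N → M₂ |
      c * (‖(List.ofFn (f ∘ Sum.inl)).prod‖ * ‖(List.ofFn (f ∘ Sum.inr)).prod‖) <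
        ‖(List.ofFn (f ∘ Sum.inl)).prod * (List.ofFn (f ∘ Sum.inr)).prod‖} :=
    isOpen_lt (continuous_const.mul (hl.norm.mul hr.norm)) (hl.mul hr).norm
  have hmem : ∀ {f : Fin N → M₂}, (∀ i, f i ∈ K₀) → ∀ X ∈ List.ofFn f, X ∈ (K₀ : Set M₂) := by
    intro f hf X hX
    obtain ⟨i, rfl⟩ := (List.mem_ofFn' f X).1 hX
    exact hf i
  have hbig : ∀ f : Fin N → M₂, (∀ i, f i ∈ K₀) → b ^ N < ‖(List.ofFn f).prod‖ := by
    intro f hf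
    have := hgrow _ (hmem hf)
    rw [List.length_ofFn] at this
    refine lt_of_lt_of_le ?_ this
    exact pow_lt_pow_left₀ hbl (by linarith) (by omega)
  filter_upwards [eventually_forall_pi_mem K₀ hopen₁ hbig,
    eventually_forall_pi_mem K₀ hopen₂ fun f hf => by
      rw [Set.mem_ofPred_eq, det_list_prod_eq_one fun X hX => hdet X (hmem hf X hX), abs_one]
      have h1 := hbig f hf
      have h2 : 1 ≤ b ^ N := one_le_pow₀ hb1.le
      rw [div_lt_iff₀ (by positivity)] at hNb
      have h3 : b ^ N < ‖(List.ofFn f).prod‖ ^ 2 := by nlinarith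
      nlinarith [mul_lt_mul_of_pos_left h3 (by positivity : 0 < c ^ 2)],
    eventually_forall_pi_mem K₀ hopen₃ fun f hf =>
      hmul (hmem fun i => hf (Sum.inl i)) (hmem fun i => hf (Sum.inr i))] with K h₁ h₂ h₃
  refine le_lowerSpectralRadius_of_blocks K.nonempty ha0.le hN1 fun l hl => ?_
  refine le_trans ?_ (pow_length_le_norm_list_prod (T := matrixProducts (K : Set M₂) N) hc hc2
    (t := b ^ N) (by positivity) ?_ ?_ ?_ l hl)
  · gcongr
  · intro X hX
    obtain ⟨f, hf, rfl⟩ := mem_matrixProducts_iff_ofFn.1 hX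
    exact (h₁ f hf).le
  · intro X hX
    obtain ⟨f, hf, rfl⟩ := mem_matrixProducts_iff_ofFn.1 hX
    exact (h₂ f hf).le
  · intro X hX Y hY
    obtain ⟨f, hf, rfl⟩ := mem_matrixProducts_iff_ofFn.1 hX
    obtain ⟨g, hg, rfl⟩ := mem_matrixProducts_iff_ofFn.1 hY
    exact (h₃ (Sum.elim f g) (by rintro (i | i); exacts [hf i, hg i])).le

theorem continuousAt_lowerSpectralRadius (K₀ : NonemptyCompacts M₂)
    (hdet : ∀ X ∈ K₀, X.det = 1) :
    ContinuousAt (fun K : NonemptyCompacts M₂ => lowerSpectralRadius (K : Set M₂)) K₀ := by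
  refine tendsto_order.2 ⟨fun a ha => ?_, fun b hb => eventually_lowerSpectralRadius_lt K₀ hb⟩
  rcases lt_or_ge a 0 with ha0 | ha0
  · exact Eventually.of_forall fun K => ha0.trans_le (lowerSpectralRadius_nonneg _)
  obtain ⟨a', haa', ha'⟩ := exists_between ha
  have h : ∀ᶠ K : NonemptyCompacts M₂ in 𝓝 K₀, a' ≤ lowerSpectralRadius (K : Set M₂) := by
    rcases lt_or_ge 1 (lowerSpectralRadius (K₀ : Set M₂)) with h1 | h1
    · exact eventually_le_lowerSpectralRadius_of_one_lt K₀ hdet h1 (ha0.trans_lt haa') ha'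
    · exact eventually_le_lowerSpectralRadius_of_lt_one K₀ hdet (ha0.trans haa'.le)
        (ha'.trans_le h1)
  exact h.mono fun K hK => haa'.trans_le hK

theorem mainTheorem7 :
    (∀ K : KSL 2, ContinuousAt (KGL.lsr : KGL 2 → ℝ) K.toKGL) ∧
      Continuous (fun K : KSL 2 => KGL.lsr K.toKGL) :=
  ⟨fun K => ContinuousAt.comp (f := fun K : KGL 2 => K.1) (x := K.toKGL)
      (continuousAt_lowerSpectralRadius K.1 K.2) continuous_subtype_val.continuousAt,
    continuous_iff_continuousAt.2 fun K => ContinuousAt.comp (f := fun K : KSL 2 => K.1) (x := K)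
      (continuousAt_lowerSpectralRadius K.1 K.2) continuous_subtype_val.continuousAt⟩
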